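/- Let $\mathbb D\subset\mathbb C$ be the open unit disc. For a domain $D\subset\mathbb C^n$, $z,w\in D$ and $X\in\mathbb C^n$, let $$l_D(z,w)=\inf\{|\alpha|:\alpha\in\mathbb D,\ \exists\varphi\in\mathcal O(\mathbb D,D):\varphi(0)=z,\ \varphi(\alpha)=w\}$$ be the Lempert function and $$\kappa_D(z;X)=\inf\{|\alpha|:\alpha\in\mathbb C,\ \exists\varphi\in\mathcal O(\mathbb D,D):\varphi(0)=z,\ \alpha\varphi'(0)=X\}$$ the Kobayashi–Royden pseudometric of $D$, where $\mathcal O(\mathbb D,D)$ is the set of holomorphic maps $\mathbb D\to D$. Let $\Omega_3\subset\mathcal M_3\cong\mathbb C^9$ be the spectral unit ball, i.e. the set of all complex $3\times3$ matrices all of whose eigenvalues lie in $\mathbb D$. Put $$A=\begin{pmatrix}0&0&0\\0&0&1\\0&0&0\end{pmatrix},\qquad B=\begin{pmatrix}1&0&0\\0&\omega&0\\0&0&\omega^2\end{pmatrix},\qquad \omega=e^{2\pi i/3}.$$ (a) One has $0<\kappa_{\Omega_3}(A;B)<\infty$, while $$\limsup_{\mathbb C\setminus\{0\}\ni t\to0}\frac{l_{\Omega_3}(A,A+tB)}{|t|}=0.$$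 (b) Let $(t_j)_j$ be a sequence in $\mathbb C\setminus\{0\}$ and $(C_j)_j$, $C_j=(c^j_{k,l})$, a sequence in $\mathcal M_3$ such that $t_j\to0$, $C_j\to B$ and $\liminf_{j\to\infty}|c^j_{3,2}/t_j-3|>0$ (the value $+\infty$ is allowed). Then $$\lim_{j\to\infty}\frac{l_{\Omega_3}(A,A+t_jC_j)}{|t_j|}=0.$$ -/

import Mathlib

open Filter Topology
open scoped ENNReal

section Disc

variable {E : Type*} [AddCommGroup E] [Module ℂ E] [TopologicalSpace E]

/-- `φ ∈ 𝒪(𝔻, D)`: the map `φ` is holomorphic on the open unit disc `𝔻` and maps it into `D`.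
The values of `φ` outside `𝔻` are irrelevant. -/
def IsAnalyticDisc (D : Set E) (φ : ℂ → E) : Prop :=
  DifferentiableOn ℂ φ (Metric.ball 0 1) ∧ Set.MapsTo φ (Metric.ball 0 1) D

/-- The Lempert function
`l_D(z, w) = inf {|α| : α ∈ 𝔻, ∃ φ ∈ 𝒪(𝔻, D), φ(0) = z, φ(α) = w}`,
with values in `[0, ∞]` (the infimum of the empty set is `∞`). -/
noncomputable def lempert (D : Set E) (z w : E) : ℝ≥0∞ :=
  sInf {r | ∃ α ∈ Metric.ball (0 : ℂ) 1, ∃ φ : ℂ → E,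
    IsAnalyticDisc D φ ∧ φ 0 = z ∧ φ α = w ∧ r = ‖α‖ₑ}

/-- The Kobayashi–Royden pseudometric
`κ_D(z; X) = inf {|α| : α ∈ ℂ, ∃ φ ∈ 𝒪(𝔻, D), φ(0) = z, α φ'(0) = X}`,
with values in `[0, ∞]` (the infimum of the empty set is `∞`). -/
noncomputable def kobayashiRoyden (D : Set E) (z X : E) : ℝ≥0∞ :=
  sInf {r | ∃ α : ℂ, ∃ φ : ℂ → E,
    IsAnalyticDisc D φ ∧ φ 0 = z ∧ α • deriv φ 0 = X ∧ r = ‖α‖ₑ}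

/-- The radial derivative of the Lempert function,
`limsup_{t → 0, t ≠ 0} l_D(z, z + t X) / |t|`, with complex `t`. -/
noncomputable def lempertRadialDeriv (D : Set E) (z X : E) : ℝ≥0∞ :=
  limsup (fun t : ℂ => lempert D z (z + t • X) / ‖t‖ₑ) (𝓝[≠] 0)

end Disc

/-- The spectral unit ball `Ω₃`: the complex `3 × 3` matrices all of whose eigenvalues lie in
the open unit disc. -/
def spectralBall₃ : Set (Matrix (Fin 3) (Fin 3) ℂ) :=
  {M | ∀ μ ∈ spectrum ℂ M, ‖μ‖ < 1}

/-- The primitive cube root of unity `ω = e^{2πi/3}`. -/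
noncomputable def omega₃ : ℂ := Complex.exp (2 * Real.pi * Complex.I / 3)

/-- The base point `A = E₂₃`. -/
def matA : Matrix (Fin 3) (Fin 3) ℂ := !![0, 0, 0; 0, 0, 1; 0, 0, 0]

/-- The direction `B = diag(1, ω, ω²)`. -/
noncomputable def matB : Matrix (Fin 3) (Fin 3) ℂ :=
  !![1, 0, 0; 0, omega₃, 0; 0, 0, omega₃ ^ 2]

/-!
Let `σ₂` denote the second coefficient of the characteristic polynomial. If `φ` is an analytic disc
through `A` with `α φ'(0) = B`, then `σ₂ ∘ φ` and `det ∘ φ` are bounded and vanish at `0` to order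
two and three. The only second-order coefficient of `φ` entering the two leading terms is that of
the entry `(3, 2)`; eliminating it leaves `|α⁻¹|³ ≤ 1 + 3 |α⁻¹|`, so `κ(A; B) ≥ 1 / 2`. Since
`A + zB` has characteristic polynomial `x³ - z³`, also `κ(A; B) ≤ 1`.

For the Lempert function the point is that `A + tC` is cyclic as soon as `c₃₂ / t` stays away
from `3`. It is then similar to the companion matrix of its characteristic polynomial, whose
coefficients are `o(t)`, `o(t)` and `o(t²)`. Hence, for every `ε ≠ 0`, it is similar to the value at
`εt` of an affine disc in the spectral ball which passes through `A` at `0`. Conjugating this disc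
by an entire curve in `GL₃(ℂ)` from `1` to the conjugating matrix shows `l(A, A + tC) ≤ |εt|`.
-/

section NormedField

variable {K : Type*} [NormedField K]

theorem norm_lt_one_of_isRoot_of_sum_norm_coeff_lt_one {p : Polynomial K} (hp : p.Monic)
    (hsum : ∑ i ∈ Finset.range p.natDegree, ‖p.coeff i‖ < 1) {x : K} (hx : p.IsRoot x) :
    ‖x‖ < 1 := by
  by_contra! hx1
  have hpow : x ^ p.natDegree = -∑ i ∈ Finset.range p.natDegree, p.coeff i * x ^ i := by
    rw [Polynomial.IsRoot.def, Polynomial.eval_eq_sum_range, Finset.sum_range_succ,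
      hp.coeff_natDegree, one_mul] at hx
    linear_combination hx
  have hle : ‖x‖ ^ p.natDegree ≤
      (∑ i ∈ Finset.range p.natDegree, ‖p.coeff i‖) * ‖x‖ ^ p.natDegree :=
    calc ‖x‖ ^ p.natDegree = ‖∑ i ∈ Finset.range p.natDegree, p.coeff i * x ^ i‖ := by
          rw [← norm_pow, hpow, norm_neg]
      _ ≤ ∑ i ∈ Finset.range p.natDegree, ‖p.coeff i‖ * ‖x‖ ^ p.natDegree := by
          refine norm_sum_le_of_le _ fun i hi => ?_
          rw [norm_mul, norm_pow]
          gcongr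
          exact (Finset.mem_range.1 hi).le
      _ = _ := (Finset.sum_mul ..).symm
  have hpos : 0 < ‖x‖ ^ p.natDegree := by positivity
  exact hsum.not_ge (le_of_mul_le_mul_right (by rwa [one_mul]) hpos)

theorem norm_charpoly_coeff_le_pow_mul_choose [IsAlgClosed K] {n : Type*} [Fintype n]
    [DecidableEq n] {M : Matrix n n K} {r : ℝ} (hM : ∀ μ ∈ spectrum K M, ‖μ‖ ≤ r) (i : ℕ) :
    ‖M.charpoly.coeff i‖ ≤ r ^ (Fintype.card n - i) * (Fintype.card n).choose i := by
  have hroots : ∀ μ ∈ (M.charpoly.map (RingHom.id K)).roots, ‖μ‖ ≤ r := fun μ hμ =>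
    hM μ (Matrix.mem_spectrum_iff_isRoot_charpoly.2
      (Polynomial.isRoot_of_mem_roots (by rwa [Polynomial.map_id] at hμ)))
  simpa using Polynomial.coeff_le_of_roots_le i M.charpoly_monic (IsAlgClosed.splits _) hroots

end NormedField

section CharpolyFinThree

variable {R : Type*} [CommRing R]

/-- The second elementary symmetric function of the eigenvalues of a `3 × 3` matrix, as the sum of
the principal `2 × 2` minors. -/
def sigmaTwo (M : Matrix (Fin 3) (Fin 3) R) : R :=
  (M 0 0 * M 1 1 - M 0 1 * M 1 0) + (M 0 0 * M 2 2 - M 0 2 * M 2 0) +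
    (M 1 1 * M 2 2 - M 1 2 * M 2 1)

theorem sigmaTwo_smul (c : R) (M : Matrix (Fin 3) (Fin 3) R) :
    sigmaTwo (c • M) = c ^ 2 * sigmaTwo M := by
  simp only [sigmaTwo, Matrix.smul_apply, smul_eq_mul]
  ring

open Polynomial in
theorem charpoly_fin_three (M : Matrix (Fin 3) (Fin 3) R) :
    M.charpoly = X ^ 3 - C M.trace * X ^ 2 + C (sigmaTwo M) * X - C M.det := by
  simp only [Matrix.charpoly, Matrix.det_fin_three, Matrix.trace_fin_three, sigmaTwo,
    Matrix.charmatrix_apply_eq, Matrix.charmatrix_apply_ne, ne_eq, Fin.reduceEq, not_false_eq_true,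
    map_add, map_sub, map_mul]
  ring

theorem charpoly_coeff_zero_fin_three (M : Matrix (Fin 3) (Fin 3) R) :
    M.charpoly.coeff 0 = -M.det := by
  simp [charpoly_fin_three, Polynomial.coeff_X]

theorem charpoly_coeff_one_fin_three (M : Matrix (Fin 3) (Fin 3) R) :
    M.charpoly.coeff 1 = sigmaTwo M := by
  simp [charpoly_fin_three, Polynomial.coeff_C]

theorem charpoly_coeff_two_fin_three (M : Matrix (Fin 3) (Fin 3) R) :
    M.charpoly.coeff 2 = -M.trace := by
  simp [charpoly_fin_three]

end CharpolyFinThree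

theorem norm_det_le_one_of_mem_spectralBall₃ {M : Matrix (Fin 3) (Fin 3) ℂ}
    (hM : M ∈ spectralBall₃) : ‖M.det‖ ≤ 1 := by
  simpa [charpoly_coeff_zero_fin_three] using
    norm_charpoly_coeff_le_pow_mul_choose (fun μ hμ => (hM μ hμ).le) 0

theorem norm_sigmaTwo_le_three_of_mem_spectralBall₃ {M : Matrix (Fin 3) (Fin 3) ℂ}
    (hM : M ∈ spectralBall₃) : ‖sigmaTwo M‖ ≤ 3 := by
  simpa [charpoly_coeff_one_fin_three] using
    norm_charpoly_coeff_le_pow_mul_choose (fun μ hμ => (hM μ hμ).le) 1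

theorem mem_spectralBall₃_of_norm_add_norm_add_norm_lt_one {M : Matrix (Fin 3) (Fin 3) ℂ}
    (h : ‖M.trace‖ + ‖sigmaTwo M‖ + ‖M.det‖ < 1) : M ∈ spectralBall₃ := by
  intro μ hμ
  refine norm_lt_one_of_isRoot_of_sum_norm_coeff_lt_one M.charpoly_monic ?_
    (Matrix.mem_spectrum_iff_isRoot_charpoly.1 hμ)
  simp only [Matrix.charpoly_natDegree_eq_dim, Fintype.card_fin, Finset.sum_range_succ,
    Finset.range_zero, Finset.sum_empty, charpoly_coeff_zero_fin_three,
    charpoly_coeff_one_fin_three, charpoly_coeff_two_fin_three, norm_neg]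
  linarith

section AffineLine

variable (t : ℂ) (C : Matrix (Fin 3) (Fin 3) ℂ)

theorem trace_matA_add_smul : (matA + t • C).trace = t * C.trace := by
  simp [matA, Matrix.trace_fin_three]

theorem sigmaTwo_matA_add_smul :
    sigmaTwo (matA + t • C) = t * (t * sigmaTwo C - C 2 1) := by
  simp only [sigmaTwo, matA, Matrix.add_apply, Matrix.smul_apply, smul_eq_mul, Matrix.of_apply,
    Matrix.cons_val]
  ring

theorem det_matA_add_smul :
    (matA + t • C).det = t ^ 2 * (t * C.det - (C 0 0 * C 2 1 - C 0 1 * C 2 0)) := by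
  simp only [Matrix.det_fin_three, matA, Matrix.add_apply, Matrix.smul_apply, smul_eq_mul,
    Matrix.of_apply, Matrix.cons_val]
  ring

end AffineLine

theorem omega₃_pow_three : omega₃ ^ 3 = 1 := by
  rw [omega₃, ← Complex.exp_nat_mul, ← Complex.exp_two_pi_mul_I]
  push_cast
  ring_nf

theorem one_add_omega₃_add_sq : 1 + omega₃ + omega₃ ^ 2 = 0 := by
  have h : IsPrimitiveRoot omega₃ 3 := by
    simpa [omega₃] using Complex.isPrimitiveRoot_exp 3 (by norm_num)
  simpa [Finset.sum_range_succ] using h.geom_sum_eq_zero (by norm_num)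

theorem trace_matB : matB.trace = 0 := by
  simpa [matB, Matrix.trace_fin_three] using one_add_omega₃_add_sq

theorem sigmaTwo_matB : sigmaTwo matB = 0 := by
  simp only [sigmaTwo, matB, Matrix.of_apply, Matrix.cons_val]
  linear_combination one_add_omega₃_add_sq + omega₃_pow_three

theorem det_matB : matB.det = 1 := by
  simp only [Matrix.det_fin_three, matB, Matrix.of_apply, Matrix.cons_val]
  linear_combination omega₃_pow_three

section Krylov

open scoped Matrix

/-- The Krylov matrix with rows `v, vN, …, vN^(n-1)`. Its determinant is nonzero exactly when the
row vector `v` is cyclic for `N`. -/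
def krylovMatrix {R : Type*} [Semiring R] {n : ℕ} (N : Matrix (Fin n) (Fin n) R) (v : Fin n → R) :
    Matrix (Fin n) (Fin n) R :=
  Matrix.of fun i => v ᵥ* N ^ (i : ℕ)

/-- An affine family of matrices equal to `matA` at `z = 0` and to the companion matrix of
`x³ - a x² + b x - c` at `z = 1`. For small `a`, `b`, `c` it is the analytic disc that bounds the
Lempert function from above. -/
def companionFamily {R : Type*} [CommRing R] (a b c z : R) : Matrix (Fin 3) (Fin 3) R :=
  !![0, z, 0; 0, 0, 1; c * z, -(b * z), a * z]

theorem companionFamily_zero (a b c : ℂ) : companionFamily a b c 0 = matA := by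
  simp [companionFamily, matA]

section CommRing

variable {R : Type*} [CommRing R] (a b c z : R)

theorem trace_companionFamily : (companionFamily a b c z).trace = a * z := by
  simp [companionFamily, Matrix.trace_fin_three]

theorem sigmaTwo_companionFamily : sigmaTwo (companionFamily a b c z) = b * z := by
  simp [companionFamily, sigmaTwo]

theorem det_companionFamily : (companionFamily a b c z).det = c * z ^ 2 := by
  simp only [Matrix.det_fin_three, companionFamily, Matrix.of_apply, Matrix.cons_val]
  ring

theorem pow_three_eq_of_fin_three (N : Matrix (Fin 3) (Fin 3) R) :
    N ^ 3 = N.det • (1 : Matrix (Fin 3) (Fin 3) R) - sigmaTwo N • N + N.trace • N ^ 2 := by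
  have h := N.aeval_self_charpoly
  simp only [charpoly_fin_three, map_add, map_sub, map_mul, map_pow, Polynomial.aeval_X,
    Polynomial.aeval_C, Algebra.algebraMap_eq_smul_one, smul_one_mul] at h
  rw [← sub_eq_zero, ← h]
  abel

theorem krylovMatrix_apply {n : ℕ} (N : Matrix (Fin n) (Fin n) R) (v : Fin n → R) (i : Fin n) :
    krylovMatrix N v i = v ᵥ* N ^ (i : ℕ) :=
  rfl

theorem krylovMatrix_mul_apply {n : ℕ} (N : Matrix (Fin n) (Fin n) R) (v : Fin n → R) (i : Fin n) :
    (krylovMatrix N v * N) i = v ᵥ* N ^ (i + 1 : ℕ) := by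
  rw [Matrix.mul_apply_eq_vecMul, krylovMatrix_apply, pow_succ, ← Matrix.vecMul_vecMul]

theorem semiconjBy_krylovMatrix_companionFamily (N : Matrix (Fin 3) (Fin 3) R) (v : Fin 3 → R) :
    SemiconjBy (krylovMatrix N v) N (companionFamily N.trace (sigmaTwo N) N.det 1) := by
  have hrow (w : Fin 3 → R) :
      w ᵥ* krylovMatrix N v = w 0 • v + w 1 • v ᵥ* N + w 2 • v ᵥ* N ^ 2 := by
    rw [Matrix.vecMul_eq_sum, Fin.sum_univ_three]
    simp [krylovMatrix_apply]
  refine funext fun i => ?_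
  rw [krylovMatrix_mul_apply, Matrix.mul_apply_eq_vecMul, hrow]
  fin_cases i
  · simp [companionFamily]
  · simp [companionFamily]
  · simp [companionFamily, pow_three_eq_of_fin_three, Matrix.vecMul_add, Matrix.vecMul_neg,
      Matrix.vecMul_smul, sub_eq_add_neg]

end CommRing

theorem semiconjBy_diagonal_companionFamily {K : Type*} [Field K] (a b c : K) {z : K}
    (hz : z ≠ 0) :
    SemiconjBy (Matrix.diagonal ![z, 1, 1]) (companionFamily a b c 1)
      (companionFamily (a / z) (b / z) (c / z ^ 2) z) := by
  rw [SemiconjBy]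
  ext i j
  rw [Matrix.diagonal_mul, Matrix.mul_diagonal]
  fin_cases i <;> fin_cases j <;> simp [companionFamily] <;> field_simp

theorem exists_det_krylovMatrix_matA_add_smul (y : ℂ) :
    ∃ Q : ℂ × Matrix (Fin 3) (Fin 3) ℂ → ℂ, Continuous Q ∧ Q (0, matB) = 3 * y ∧
      ∀ t C, (krylovMatrix (matA + t • C) ![y, 1, 0]).det =
        t * (t * Q (t, C) -
          (1 + t * C 1 2 + t * y * C 0 2) ^ 2 * (y * C 2 1 - C 2 0)) := by
  -- For `N = A + tC` and `v = (y, 1, 0)`: `vN = (tp, tq, r)`, and the last entry of `vN²` is `ts`.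
  let p (x : ℂ × Matrix (Fin 3) (Fin 3) ℂ) := y * x.2 0 0 + x.2 1 0
  let q (x : ℂ × Matrix (Fin 3) (Fin 3) ℂ) := y * x.2 0 1 + x.2 1 1
  let r (x : ℂ × Matrix (Fin 3) (Fin 3) ℂ) := 1 + x.1 * x.2 1 2 + x.1 * y * x.2 0 2
  let s (x : ℂ × Matrix (Fin 3) (Fin 3) ℂ) :=
    x.1 * (p x * x.2 0 2 + q x * x.2 1 2) + q x + r x * x.2 2 2
  refine ⟨fun x => y * (q x * s x - r x * (p x * x.2 0 1 + q x * x.2 1 1)) -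
    (p x * s x - r x * (p x * x.2 0 0 + q x * x.2 1 0)), by fun_prop, ?_, fun t C => ?_⟩
  · simp only [p, q, r, s, matB, Matrix.of_apply, Matrix.cons_val]
    linear_combination (-y) * one_add_omega₃_add_sq + y * omega₃_pow_three
  · rw [Matrix.det_fin_three]
    simp only [krylovMatrix_apply, Fin.val_zero, Fin.val_one, Fin.val_two, pow_zero, pow_one,
      pow_two, Matrix.vecMul_one, ← Matrix.vecMul_vecMul]
    simp only [p, q, r, s, Matrix.vecMul, dotProduct, Fin.sum_univ_three, matA, Matrix.add_apply,
      Matrix.smul_apply, smul_eq_mul, Matrix.of_apply, Matrix.cons_val]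
    ring

end Krylov

theorem norm_apply_zero_le_of_norm_pow_smul_le {E : Type*} [NormedAddCommGroup E]
    [NormedSpace ℂ E] {F : ℂ → E} {n : ℕ} {c : ℝ} (hF : DifferentiableOn ℂ F (Metric.ball 0 1))
    (h : ∀ z ∈ Metric.ball (0 : ℂ) 1, ‖z ^ n • F z‖ ≤ c) : ‖F 0‖ ≤ c := by
  have hr : ∀ r ∈ Set.Ioo (0 : ℝ) 1, ‖F 0‖ * r ^ n ≤ c := by
    rintro r ⟨hr0, hr1⟩
    rw [← le_div_iff₀ (by positivity)]
    refine Complex.norm_le_of_forall_mem_frontier_norm_le Metric.isBounded_ball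
      ((hF.mono (Metric.closedBall_subset_ball hr1)).diffContOnCl_ball subset_rfl) (fun z hz => ?_)
      (subset_closure (Metric.mem_ball_self hr0))
    rw [frontier_ball _ hr0.ne', mem_sphere_zero_iff_norm] at hz
    have hz1 := h z (by simpa [hz] using hr1)
    rwa [norm_smul, norm_pow, hz, mul_comm, ← le_div_iff₀ (by positivity)] at hz1
  have hlim : Tendsto (fun r : ℝ => ‖F 0‖ * r ^ n) (𝓝[<] 1) (𝓝 (‖F 0‖ * 1 ^ n)) :=
    (by fun_prop : Continuous fun r : ℝ => ‖F 0‖ * r ^ n).continuousWithinAt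
  simpa using le_of_tendsto hlim (mem_of_superset (Ioo_mem_nhdsLT zero_lt_one) hr)

section Holomorphic

-- Differentiability of matrix-valued maps only depends on the topology, so any norm will do.
-- This one makes matrices a normed algebra.
attribute [local instance] Matrix.linftyOpNormedRing Matrix.linftyOpNormedAlgebra

variable {n : Type*} [Fintype n] [DecidableEq n]

theorem exists_differentiable_path_of_det_ne_zero {M : Matrix n n ℂ} (hM : M.det ≠ 0) :
    ∃ P : ℂ → Matrix n n ℂ,
      Differentiable ℂ P ∧ (∀ z, (P z).det ≠ 0) ∧ P 0 = 1 ∧ P 1 = M := by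
  refine Matrix.diagonal_transvection_induction_of_det_ne_zero (fun M => ∃ P : ℂ → Matrix n n ℂ,
    Differentiable ℂ P ∧ (∀ z, (P z).det ≠ 0) ∧ P 0 = 1 ∧ P 1 = M) M hM (fun d hd => ?diagonal)
    (fun T => ?transvection) fun A B _ _ ⟨P, hP, hPdet, hP0, hP1⟩ ⟨Q, hQ, hQdet, hQ0, hQ1⟩ => ?mul
  case diagonal =>
    have hd' : ∀ i, d i ≠ 0 := by
      simpa [Matrix.det_diagonal, Finset.prod_ne_zero_iff] using hd
    refine ⟨fun z => Matrix.diagonal fun i => Complex.exp (z * Complex.log (d i)), ?_, ?_, ?_, ?_⟩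
    · refine (Matrix.diagonalLinearMap n ℂ ℂ).toContinuousLinearMap.differentiable.comp ?_
      fun_prop
    · simp [Matrix.det_diagonal, Finset.prod_ne_zero_iff]
    · simp
    · simp [Complex.exp_log (hd' _)]
  case transvection =>
    refine ⟨fun z => 1 + z • Matrix.single T.i T.j T.c, by fun_prop, fun z => ?_, by simp, ?_⟩
    · simpa [Matrix.transvection] using
        (Matrix.det_transvection_of_ne T.i T.j T.hij (z * T.c)).trans_ne one_ne_zero
    · simp [Matrix.TransvectionStruct.toMatrix, Matrix.transvection]
  case mul =>
    exact ⟨fun z => P z * Q z, by fun_prop, fun z => by simp [hPdet, hQdet], by simp [hP0, hQ0],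
      by simp [hP1, hQ1]⟩

theorem lempert_le_enorm_of_semiconjBy {D : Set (Matrix n n ℂ)}
    (hD : ∀ M ∈ D, ∀ P : Matrix n n ℂ, P.det ≠ 0 → P⁻¹ * M * P ∈ D) {F : ℂ → Matrix n n ℂ}
    (hF : IsAnalyticDisc D F) {α : ℂ} (hα0 : α ≠ 0) (hα1 : ‖α‖ < 1) {N T : Matrix n n ℂ}
    (hT : T.det ≠ 0) (hTN : SemiconjBy T N (F α)) : lempert D (F 0) N ≤ ‖α‖ₑ := by
  obtain ⟨P, hP, hPdet, hP0, hP1⟩ := exists_differentiable_path_of_det_ne_zero hT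
  refine sInf_le ⟨α, by simpa using hα1, fun z => (P (z / α))⁻¹ * F z * P (z / α),
    ⟨?_, fun z hz => hD _ (hF.2 hz) _ (hPdet _)⟩, by simp [hP0], ?_, rfl⟩
  · have hinv : Differentiable ℂ fun z => (P z)⁻¹ := by
      simp_rw [Matrix.nonsing_inv_eq_ringInverse]
      exact hP.inverse fun z => (Matrix.isUnit_iff_isUnit_det _).2 (hPdet z).isUnit
    have h1 : Differentiable ℂ fun z => P (z / α) := hP.comp (by fun_prop)
    have h2 : Differentiable ℂ fun z => (P (z / α))⁻¹ := hinv.comp (by fun_prop)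
    exact (h2.differentiableOn.mul hF.1).mul h1.differentiableOn
  · simp only [div_self hα0, hP1]
    rw [mul_assoc, ← hTN.eq, Matrix.nonsing_inv_mul_cancel_left _ _ hT.isUnit]

theorem inv_mul_mul_mem_spectralBall₃ {M : Matrix (Fin 3) (Fin 3) ℂ} (hM : M ∈ spectralBall₃)
    {P : Matrix (Fin 3) (Fin 3) ℂ} (hP : P.det ≠ 0) : P⁻¹ * M * P ∈ spectralBall₃ := by
  lift P to (Matrix (Fin 3) (Fin 3) ℂ)ˣ using (Matrix.isUnit_iff_isUnit_det _).2 hP.isUnit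
  rw [← Matrix.coe_units_inv]
  simpa only [spectralBall₃, Set.mem_ofPred_eq, spectrum.units_conjugate'] using hM

theorem isAnalyticDisc_companionFamily {a b c : ℂ} (h : ‖a‖ + ‖b‖ + ‖c‖ < 1) :
    IsAnalyticDisc spectralBall₃ (companionFamily a b c) := by
  refine ⟨?_, fun z hz => mem_spectralBall₃_of_norm_add_norm_add_norm_lt_one (lt_of_le_of_lt ?_ h)⟩
  · have haffine : companionFamily a b c = fun z => matA + z • !![0, 1, 0; 0, 0, 0; c, -b, a] := by
      funext z
      simp [companionFamily, matA, mul_comm]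
    rw [haffine]
    fun_prop
  · have hz1 : ‖z‖ ≤ 1 := (mem_ball_zero_iff.1 hz).le
    simp only [trace_companionFamily, sigmaTwo_companionFamily, det_companionFamily, norm_mul,
      norm_pow]
    gcongr <;> refine mul_le_of_le_one_right (norm_nonneg _) ?_
    exacts [hz1, hz1, pow_le_one₀ (norm_nonneg _) hz1]

theorem lempert_matA_le_enorm {N : Matrix (Fin 3) (Fin 3) ℂ} {v : Fin 3 → ℂ} {α : ℂ} (hα0 : α ≠ 0)
    (hα1 : ‖α‖ < 1) (hv : (krylovMatrix N v).det ≠ 0)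
    (hN : ‖N.trace / α‖ + ‖sigmaTwo N / α‖ + ‖N.det / α ^ 2‖ < 1) :
    lempert spectralBall₃ matA N ≤ ‖α‖ₑ := by
  have hdet : (Matrix.diagonal ![α, 1, 1] * krylovMatrix N v).det ≠ 0 := by
    simp [Matrix.det_diagonal, Fin.prod_univ_three, hα0, hv]
  simpa only [companionFamily_zero] using
    lempert_le_enorm_of_semiconjBy (fun _ hM _ hP => inv_mul_mul_mem_spectralBall₃ hM hP)
      (isAnalyticDisc_companionFamily hN) hα0 hα1 hdet
      ((semiconjBy_diagonal_companionFamily _ _ _ hα0).mul_left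
        (semiconjBy_krylovMatrix_companionFamily N v))

theorem exists_differentiableOn_eq_add_smul {E : Type*} [NormedAddCommGroup E] [NormedSpace ℂ E]
    [CompleteSpace E] {f : ℂ → E} {s : Set ℂ} (hs : s ∈ 𝓝 0) (hf : DifferentiableOn ℂ f s) :
    ∃ g : ℂ → E, DifferentiableOn ℂ g s ∧ g 0 = deriv f 0 ∧ ∀ z, f z = f 0 + z • g z :=
  ⟨dslope f 0, (Complex.differentiableOn_dslope hs).2 hf, dslope_same f 0, fun z => by
    simpa using eq_add_of_sub_eq' (sub_smul_dslope f 0 z).symm⟩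

theorem norm_det_sub_mul_sigmaTwo_le {X : ℂ → Matrix (Fin 3) (Fin 3) ℂ}
    (hX : DifferentiableOn ℂ X (Metric.ball 0 1))
    (hmem : ∀ z ∈ Metric.ball 0 1, matA + z • X z ∈ spectralBall₃) (h01 : X 0 0 1 = 0)
    (h20 : X 0 2 0 = 0) (h21 : X 0 2 1 = 0) :
    ‖(X 0).det - X 0 0 0 * sigmaTwo (X 0)‖ ≤ 1 + 3 * ‖X 0 0 0‖ := by
  have hball : Metric.ball (0 : ℂ) 1 ∈ 𝓝 0 := Metric.ball_mem_nhds 0 one_pos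
  obtain ⟨Y01, hY01d, -, hY01⟩ := exists_differentiableOn_eq_add_smul hball
    (by fun_prop : DifferentiableOn ℂ (fun z => X z 0 1) (Metric.ball 0 1))
  obtain ⟨Y21, hY21d, -, hY21⟩ := exists_differentiableOn_eq_add_smul hball
    (by fun_prop : DifferentiableOn ℂ (fun z => X z 2 1) (Metric.ball 0 1))
  simp only [h01, h21, zero_add, smul_eq_mul] at hY01 hY21
  have hsigma : ‖sigmaTwo (X 0) - Y21 0‖ ≤ 3 := by
    refine norm_apply_zero_le_of_norm_pow_smul_le (n := 2) (F := fun z => sigmaTwo (X z) - Y21 z)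
      (by unfold sigmaTwo; fun_prop) fun z hz => ?_
    refine (congrArg norm ?_).trans_le (norm_sigmaTwo_le_three_of_mem_spectralBall₃ (hmem z hz))
    rw [sigmaTwo_matA_add_smul, hY21, smul_eq_mul]
    ring
  have hdet : ‖(X 0).det - (X 0 0 0 * Y21 0 - Y01 0 * X 0 2 0)‖ ≤ 1 := by
    refine norm_apply_zero_le_of_norm_pow_smul_le (n := 3)
      (F := fun z => (X z).det - (X z 0 0 * Y21 z - Y01 z * X z 2 0))
      (by simp only [Matrix.det_fin_three]; fun_prop) fun z hz => ?_
    refine (congrArg norm ?_).trans_le (norm_det_le_one_of_mem_spectralBall₃ (hmem z hz))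
    rw [det_matA_add_smul, hY21, hY01, smul_eq_mul]
    ring
  rw [h20, mul_zero, sub_zero] at hdet
  -- The unknown second-order coefficient `Y21 0` enters both bounds; this eliminates it.
  calc ‖(X 0).det - X 0 0 0 * sigmaTwo (X 0)‖
      = ‖((X 0).det - X 0 0 0 * Y21 0) - X 0 0 0 * (sigmaTwo (X 0) - Y21 0)‖ := by ring_nf
    _ ≤ 1 + ‖X 0 0 0‖ * 3 := by
      refine (norm_sub_le _ _).trans ?_
      rw [norm_mul]
      gcongr
    _ = 1 + 3 * ‖X 0 0 0‖ := by ring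

theorem norm_det_deriv_sub_mul_sigmaTwo_deriv_le {φ : ℂ → Matrix (Fin 3) (Fin 3) ℂ}
    (hφ : IsAnalyticDisc spectralBall₃ φ) (h0 : φ 0 = matA) (h01 : deriv φ 0 0 1 = 0)
    (h20 : deriv φ 0 2 0 = 0) (h21 : deriv φ 0 2 1 = 0) :
    ‖(deriv φ 0).det - deriv φ 0 0 0 * sigmaTwo (deriv φ 0)‖ ≤ 1 + 3 * ‖deriv φ 0 0 0‖ := by
  obtain ⟨X, hX, hX0, hφX⟩ :=
    exists_differentiableOn_eq_add_smul (Metric.ball_mem_nhds 0 one_pos) hφ.1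
  have hderiv : deriv φ 0 = X 0 := hX0.symm
  rw [hderiv] at h01 h20 h21 ⊢
  refine norm_det_sub_mul_sigmaTwo_le hX (fun z hz => ?_) h01 h20 h21
  rw [← h0, ← hφX]
  exact hφ.2 hz

theorem inv_two_le_kobayashiRoyden_matA_matB : 2⁻¹ ≤ kobayashiRoyden spectralBall₃ matA matB := by
  refine le_sInf ?_
  rintro r ⟨α, φ, hφ, h0, hα, rfl⟩
  have hα0 : α ≠ 0 := by
    rintro rfl
    simpa [matB] using congrFun (congrFun hα 0) 0
  have hderiv : deriv φ 0 = α⁻¹ • matB := by rw [← hα, inv_smul_smul₀ hα0]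
  have h := norm_det_deriv_sub_mul_sigmaTwo_deriv_le hφ h0 (by simp [hderiv, matB])
    (by simp [hderiv, matB]) (by simp [hderiv, matB])
  rw [hderiv, Matrix.det_smul, det_matB, sigmaTwo_smul, sigmaTwo_matB] at h
  have hcubic : ‖α⁻¹‖ ^ 3 ≤ 1 + 3 * ‖α⁻¹‖ := by simpa [matB] using h
  have hle : ‖α⁻¹‖ₑ ≤ 2 := by
    rw [← ofReal_norm, ENNReal.ofReal_le_ofNat]
    by_contra! hlt
    nlinarith [mul_pos (sub_pos.2 hlt) (sub_pos.2 hlt)]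
  rwa [enorm_inv hα0, ENNReal.inv_le_iff_inv_le] at hle

theorem isAnalyticDisc_matA_add_smul_matB :
    IsAnalyticDisc spectralBall₃ fun z : ℂ => matA + z • matB := by
  refine ⟨by fun_prop, fun z hz x hx => ?_⟩
  have hxz : x ^ 3 = z ^ 3 := by
    rw [Matrix.mem_spectrum_iff_isRoot_charpoly, charpoly_fin_three, trace_matA_add_smul,
      sigmaTwo_matA_add_smul, det_matA_add_smul, trace_matB, sigmaTwo_matB, det_matB] at hx
    refine sub_eq_zero.1 ?_
    simpa [matB, ← pow_succ] using hx
  rw [← pow_lt_one_iff_of_nonneg (norm_nonneg x) three_ne_zero, ← norm_pow, hxz, norm_pow]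
  exact pow_lt_one₀ (norm_nonneg z) (mem_ball_zero_iff.1 hz) three_ne_zero

theorem kobayashiRoyden_matA_matB_le_one : kobayashiRoyden spectralBall₃ matA matB ≤ 1 := by
  refine sInf_le ⟨1, _, isAnalyticDisc_matA_add_smul_matB, by simp, ?_, by simp⟩
  have hderiv : HasDerivAt (fun z : ℂ => matA + z • matB) ((1 : ℂ) • matB) 0 :=
    ((hasDerivAt_id' 0).smul_const matB).const_add matA
  rw [one_smul]
  exact hderiv.deriv.trans (one_smul ℂ matB)

end Holomorphic

theorem tendsto_div_enorm_zero {𝕜 ι : Type*} [NontriviallyNormedField 𝕜] {l : Filter ι}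
    {f : ι → ℝ≥0∞} {t : ι → 𝕜} (h : ∀ ε ≠ 0, ∀ᶠ j in l, f j ≤ ‖ε * t j‖ₑ) :
    Tendsto (fun j => f j / ‖t j‖ₑ) l (𝓝 0) := by
  refine ENNReal.tendsto_nhds_zero.2 fun δ hδ => ?_
  have hsmall : ∀ᶠ ε : 𝕜 in 𝓝[≠] 0, ‖ε‖ₑ < δ := nhdsWithin_le_nhds
    ((continuous_enorm.tendsto' 0 0 enorm_zero).eventually_lt_const hδ)
  obtain ⟨ε, hεδ, hε0⟩ := (hsmall.and eventually_mem_nhdsWithin).exists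
  filter_upwards [h ε hε0] with j hj
  refine ENNReal.div_le_of_le_mul (hj.trans ?_)
  rw [enorm_mul]
  gcongr

theorem eventually_exists_det_krylovMatrix_ne_zero {δ : ℝ} (hδ : 0 < δ) :
    ∀ᶠ x : ℂ × Matrix (Fin 3) (Fin 3) ℂ in 𝓝 (0, matB), x.1 ≠ 0 → δ ≤ ‖x.2 2 1 / x.1 - 3‖ →
      ∃ v, (krylovMatrix (matA + x.1 • x.2) v).det ≠ 0 := by
  obtain ⟨P, hPc, hPB, hP⟩ := exists_det_krylovMatrix_matA_add_smul 1
  obtain ⟨Q, hQc, hQB, hQ⟩ := exists_det_krylovMatrix_matA_add_smul (-1)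
  -- If neither `(1, 1, 0)` nor `(-1, 1, 0)` is cyclic, the difference of the two determinants gives
  -- `c₃₂ / t = G / H`, which tends to `6 / 2 = 3`.
  let G (x : ℂ × Matrix (Fin 3) (Fin 3) ℂ) :=
    P x - Q x + 4 * (1 + x.1 * x.2 1 2) * x.2 0 2 * x.2 2 0
  let H (x : ℂ × Matrix (Fin 3) (Fin 3) ℂ) :=
    (1 + x.1 * x.2 1 2 + x.1 * x.2 0 2) ^ 2 + (1 + x.1 * x.2 1 2 - x.1 * x.2 0 2) ^ 2
  have hG : G (0, matB) = 6 := by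
    have h02 : matB 0 2 = 0 := by simp [matB]
    norm_num [G, hPB, hQB, h02]
  have hH : H (0, matB) = 2 := by norm_num [H]
  have hHc : Continuous H := by fun_prop
  have hGc : Continuous G := by fun_prop
  have hHne : H (0, matB) ≠ 0 := by simp [hH]
  have hGH : Tendsto (fun x => G x / H x) (𝓝 (0, matB)) (𝓝 3) := by
    have h3 : G (0, matB) / H (0, matB) = 3 := by norm_num only [hG, hH]
    exact h3 ▸ (hGc.continuousAt.div hHc.continuousAt hHne).tendsto
  filter_upwards [Metric.tendsto_nhds.1 hGH δ hδ, hHc.continuousAt.eventually_ne hHne]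
    with x hx hHx hx0 hδx
  by_contra! hdet
  have hquot : x.2 2 1 / x.1 = G x / H x := by
    rw [div_eq_div_iff hx0 hHx]
    refine mul_left_cancel₀ hx0 ?_
    linear_combination hP x.1 x.2 - hQ x.1 x.2 - hdet ![1, 1, 0] + hdet ![-1, 1, 0]
  rw [hquot, ← dist_eq_norm] at hδx
  exact hx.not_ge hδx

theorem eventually_norm_div_add_norm_div_add_norm_div_lt_one (ε : ℂ) :
    ∀ᶠ x : ℂ × Matrix (Fin 3) (Fin 3) ℂ in 𝓝 (0, matB), x.1 ≠ 0 →
      ‖(matA + x.1 • x.2).trace / (ε * x.1)‖ + ‖sigmaTwo (matA + x.1 • x.2) / (ε * x.1)‖ +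
        ‖(matA + x.1 • x.2).det / (ε * x.1) ^ 2‖ < 1 := by
  let f (x : ℂ × Matrix (Fin 3) (Fin 3) ℂ) : ℝ :=
    ‖x.2.trace / ε‖ + ‖(x.1 * sigmaTwo x.2 - x.2 2 1) / ε‖ +
      ‖(x.1 * x.2.det - (x.2 0 0 * x.2 2 1 - x.2 0 1 * x.2 2 0)) / ε ^ 2‖
  have hfc : Continuous f := by
    simp only [f, sigmaTwo]
    fun_prop
  have hf0 : f (0, matB) = 0 := by
    simp only [f, trace_matB]
    simp [matB]
  filter_upwards [hfc.continuousAt.eventually_lt_const (hf0.trans_lt one_pos)] with x hx hx0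
  refine lt_of_eq_of_lt ?_ hx
  simp only [f, trace_matA_add_smul, sigmaTwo_matA_add_smul, det_matA_add_smul, mul_comm ε,
    mul_pow, mul_div_mul_left _ _ hx0, mul_div_mul_left _ _ (pow_ne_zero 2 hx0)]

theorem eventually_lempert_matA_le_enorm {δ : ℝ} (hδ : 0 < δ) {ε : ℂ} (hε : ε ≠ 0) :
    ∀ᶠ x : ℂ × Matrix (Fin 3) (Fin 3) ℂ in 𝓝 (0, matB), x.1 ≠ 0 → δ ≤ ‖x.2 2 1 / x.1 - 3‖ →
      lempert spectralBall₃ matA (matA + x.1 • x.2) ≤ ‖ε * x.1‖ₑ := by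
  have hnorm : ∀ᶠ x : ℂ × Matrix (Fin 3) (Fin 3) ℂ in 𝓝 (0, matB), ‖ε * x.1‖ < 1 :=
    (by fun_prop : Continuous fun x : ℂ × Matrix (Fin 3) (Fin 3) ℂ => ‖ε * x.1‖)
      |>.continuousAt.eventually_lt_const (by simp)
  filter_upwards [hnorm, eventually_exists_det_krylovMatrix_ne_zero hδ,
    eventually_norm_div_add_norm_div_add_norm_div_lt_one ε] with x hx1 hkrylov hsum hx0 hδx
  obtain ⟨v, hv⟩ := hkrylov hx0 hδx
  exact lempert_matA_le_enorm (mul_ne_zero hε hx0) hx1 hv (hsum hx0)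

theorem tendsto_lempert_div_enorm {ι : Type*} {l : Filter ι} {t : ι → ℂ}
    {C : ι → Matrix (Fin 3) (Fin 3) ℂ} (ht0 : ∀ᶠ j in l, t j ≠ 0) (ht : Tendsto t l (𝓝 0))
    (hC : Tendsto C l (𝓝 matB)) (hlim : 0 < liminf (fun j => ‖C j 2 1 / t j - 3‖ₑ) l) :
    Tendsto (fun j => lempert spectralBall₃ matA (matA + t j • C j) / ‖t j‖ₑ) l (𝓝 0) := by
  obtain ⟨δ, hδ, hδlim⟩ := ENNReal.lt_iff_exists_nnreal_btwn.1 hlim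
  refine tendsto_div_enorm_zero fun ε hε => ?_
  filter_upwards [ht0, eventually_lt_of_lt_liminf hδlim, (ht.prodMk_nhds hC).eventually
    (eventually_lempert_matA_le_enorm (NNReal.coe_pos.2 (ENNReal.coe_pos.1 hδ)) hε)]
    with j hj0 hδj hj
  exact hj hj0 (mod_cast hδj.le)

theorem lempertRadialDeriv_matA_matB : lempertRadialDeriv spectralBall₃ matA matB = 0 := by
  refine (tendsto_lempert_div_enorm (l := 𝓝[≠] 0) eventually_mem_nhdsWithin
    (tendsto_id.mono_left nhdsWithin_le_nhds) tendsto_const_nhds ?_).limsup_eq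
  simp [matB]

theorem proposition1 :
    -- (a), including that the infimum defining the pseudometric is a finite number
    (0 < kobayashiRoyden spectralBall₃ matA matB ∧
      kobayashiRoyden spectralBall₃ matA matB < ∞ ∧
      lempertRadialDeriv spectralBall₃ matA matB = 0) ∧
    -- (b); the entry in row 3, column 2 is `C j 2 1`
    (∀ (t : ℕ → ℂ) (C : ℕ → Matrix (Fin 3) (Fin 3) ℂ),
      (∀ j, t j ≠ 0) → Tendsto t atTop (𝓝 0) → Tendsto C atTop (𝓝 matB) →
      0 < liminf (fun j => ‖C j 2 1 / t j - 3‖ₑ) atTop →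
      Tendsto (fun j => lempert spectralBall₃ matA (matA + t j • C j) / ‖t j‖ₑ)
        atTop (𝓝 0)) := by
  refine ⟨⟨?pos, ?finite, lempertRadialDeriv_matA_matB⟩, fun t C ht0 ht hC hlim =>
    tendsto_lempert_div_enorm (.of_forall ht0) ht hC hlim⟩
  case pos => exact lt_of_lt_of_le (by simp) inv_two_le_kobayashiRoyden_matA_matB
  case finite => exact kobayashiRoyden_matA_matB_le_one.trans_lt ENNReal.one_lt_top
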